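/- Conventions: $d\theta(X,Y)=\tfrac12\big(X\theta(Y)-Y\theta(X)-\theta([X,Y])\big)$ and $(\alpha\wedge\beta)(X,Y)=\tfrac12\big(\alpha(X)\beta(Y)-\alpha(Y)\beta(X)\big)$. Let $\bar M$ be a normal complex contact metric manifold of complex dimension $2m+1$. That is: $\bar M$ is a complex manifold with complex structure $\bar J$, a smooth Hermitian metric $g$ with Levi-Civita connection $\bar\nabla$, and an open covering by sets $\mathcal U$ carrying holomorphic $1$-forms $\omega$ with $\omega\wedge(d\omega)^m\ne 0$ that differ by holomorphic factors on overlaps; on each $\mathcal U$ there are a smooth real $1$-form $\bar u$ with $g$-dual vector field $\bar U$, $\bar u(\bar U)=1$, the form $\bar v=\bar u\circ\bar J$, the vector field $\bar V=-\bar J\bar U$, a smooth $(1,1)$-tensor field $\bar G$ and $\bar H=\bar G\bar J$ such that $\bar G^2=\bar H^2=-I+\bar u\otimes\bar U+\bar v\otimes\bar V$, $\bar G\bar J=-\bar J\bar G$, $\bar G\bar U=0$, $g(K,\bar GL)=-g(\bar GK,L)$, $\omega$ is $\bar u-i\bar v$ times a non-vanishing complex function, and $$d\bar u(K,L)=g(K,\bar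 GL)+(\sigma\wedge\bar v)(K,L),\quad d\bar v(K,L)=g(K,\bar HL)-(\sigma\wedge\bar u)(K,L),\quad \sigma(K)=g(\bar\nabla_K\bar U,\bar V);$$ on overlaps, for some functions $a,b$ with $a^2+b^2=1$, the local data are related by $\bar u'=a\bar u-b\bar v$, $\bar v'=b\bar u+a\bar v$, $\bar G'=a\bar G-b\bar H$, $\bar H'=b\bar G+a\bar H$. Normality means that the tensors $$\begin{aligned}S(K,L)={}&[\bar G,\bar G](K,L)+2g(K,\bar GL)\bar U-2g(K,\bar HL)\bar V+2\big(\bar v(L)\bar HK-\bar v(K)\bar HL\big)\\&+\sigma(\bar GL)\bar HK-\sigma(\bar GK)\bar HL+\sigma(K)\bar G\bar HL-\sigma(L)\bar G\bar HK,\\ T(K,L)={}&[\bar H,\bar H](K,L)-2g(K,\bar GL)\bar U+2g(K,\bar HL)\bar V+2\big(\bar u(L)\bar GK-\bar u(K)\bar GL\big)\\&+\sigma(\bar HK)\bar GL-\sigma(\bar HL)\bar GK+\sigma(K)\bar G\bar HL-\sigma(L)\bar G\bar HK\end{aligned}$$ ($[A,A](K,L)=(\bar\nabla_{AK}A)L-(\bar\nabla_{AL}A)K-A(\bar\nabla_KA)L+A(\bar\nabla_LA)K$)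 vanish for $K,L\in\ker\omega$, and $S(K,\bar U)=T(K,\bar V)=0$ for all $K$. Let $M$ be a complex (holomorphically immersed) Hausdorff submanifold of $\bar M$ to which $\bar U,\bar V$ are tangent. For $K\in T_pM$ let $PK$ and $QK$ be the tangential and the normal part of $\bar GK$, and put $$\mathcal D_p=\{K\in T_pM: K\perp\bar U,\bar V,\ QK=0\},\qquad \mathcal D^\perp_p=\{K\in T_pM: K\perp\bar U,\bar V,\ PK=0\}.$$ Suppose that $M$ is semi-invariant: $\mathcal D$ (the invariant distribution) and $\mathcal D^\perp$ have constant dimension and are differentiable distributions on $M$. **Theorem.** If $\mathcal D\neq 0$, then $\mathcal D$ is not involutive. More precisely, for all $K,L\in\Gamma(\mathcal D)$, $$g([K,L],\bar U)=2g(\bar GK,L),\qquad g([K,L],\bar V)=2g(\bar HK,L),$$ and for every $p\in M$ and every local $\bar U$ defined near $p$ there are $K,L\in\Gamma(\mathcal D)$ with $g([K,L],\bar U)_p\neq0$. -/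

import Mathlib

open scoped Manifold ContDiff Topology
open Bundle

namespace ComplexContact

/-! ### The real manifold underlying a complex manifold -/

/-- A complex manifold, charted on the complex vector space `E`, is a real analytic (in particular
smooth) manifold for the same charts. -/
instance isManifold_real_of_complex {E : Type*} [NormedAddCommGroup E] [NormedSpace ℂ E]
    {M : Type*} [TopologicalSpace M] [ChartedSpace E M] [h : IsManifold 𝓘(ℂ, E) ω M] :
    IsManifold 𝓘(ℝ, E) ω M := by
  refine isManifold_of_contDiffOn 𝓘(ℝ, E) ω M fun e e' he he' ↦ ?_
  have h1 := (contDiffGroupoid ω 𝓘(ℂ, E)).compatible he he'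
  rw [contDiffGroupoid, mem_groupoid_of_pregroupoid] at h1
  exact h1.1.restrict_scalars ℝ

/-- The complex structure `J` of the tangent spaces: multiplication by `i`. (The tangent space at
`p` is the model space, read in the preferred chart at `p`; since the changes of charts are
holomorphic, multiplication by `i` is the same in any holomorphic chart.) -/
noncomputable def J {E : Type*} [NormedAddCommGroup E] [NormedSpace ℂ E]
    {M : Type*} [TopologicalSpace M] [ChartedSpace E M] (p : M) :
    TangentSpace 𝓘(ℝ, E) p →L[ℝ] TangentSpace 𝓘(ℝ, E) p :=
  (Complex.I • ContinuousLinearMap.id ℝ E : E →L[ℝ] E)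

/-! ### Exterior derivative, Levi-Civita connection -/

/-- The exterior derivative of a 1-form, with the normalisation
`dθ(X, Y) = ½ (X θ(Y) - Y θ(X) - θ([X, Y]))`. The right hand side is tensorial in `X` and `Y`, and
is evaluated on local extensions of the tangent vectors `x` and `y`. -/
noncomputable def extDerivOneForm {𝕜 : Type*} [NontriviallyNormedField 𝕜]
    {E : Type*} [NormedAddCommGroup E] [NormedSpace 𝕜 E]
    {M : Type*} [TopologicalSpace M] [ChartedSpace E M] [IsManifold 𝓘(𝕜, E) 1 M]
    (θ : Π p : M, TangentSpace 𝓘(𝕜, E) p →L[𝕜] 𝕜) (p : M) (x y : TangentSpace 𝓘(𝕜, E) p) : 𝕜 :=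
  let X : Π q : M, TangentSpace 𝓘(𝕜, E) q := FiberBundle.extend E x
  let Y : Π q : M, TangentSpace 𝓘(𝕜, E) q := FiberBundle.extend E y
  (1 / 2) * (mvfderiv 𝓘(𝕜, E) (fun q ↦ θ q (Y q)) p x - mvfderiv 𝓘(𝕜, E) (fun q ↦ θ q (X q)) p y
    - θ p (VectorField.mlieBracket 𝓘(𝕜, E) X Y p))

section LeviCivita

variable {E : Type*} [NormedAddCommGroup E] [NormedSpace ℂ E] [FiniteDimensional ℂ E]
  {M : Type*} [TopologicalSpace M] [ChartedSpace E M] [IsManifold 𝓘(ℂ, E) ω M]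
  [RiemannianBundle (fun p : M ↦ TangentSpace 𝓘(ℝ, E) p)]

instance finiteDimensional_tangentSpace (p : M) : FiniteDimensional ℝ (TangentSpace 𝓘(ℝ, E) p) :=
  inferInstanceAs (FiniteDimensional ℝ E)

/-- The right hand side of the Koszul formula for `g(∇_X Y, Z)`. -/
noncomputable def koszul (X Y Z : Π p : M, TangentSpace 𝓘(ℝ, E) p) (p : M) : ℝ :=
  (1 / 2) * (mvfderiv 𝓘(ℝ, E) (fun q ↦ inner ℝ (Y q) (Z q)) p (X p)
    + mvfderiv 𝓘(ℝ, E) (fun q ↦ inner ℝ (Z q) (X q)) p (Y p)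
    - mvfderiv 𝓘(ℝ, E) (fun q ↦ inner ℝ (X q) (Y q)) p (Z p)
    + inner ℝ (VectorField.mlieBracket 𝓘(ℝ, E) X Y p) (Z p)
    - inner ℝ (VectorField.mlieBracket 𝓘(ℝ, E) Y Z p) (X p)
    + inner ℝ (VectorField.mlieBracket 𝓘(ℝ, E) Z X p) (Y p))

/-- The Levi-Civita connection: `∇_X Y` at `p` is the vector whose scalar product with each vector
`e a` of an orthonormal basis of the tangent space is given by the Koszul formula. -/
noncomputable def leviCivita (X Y : Π p : M, TangentSpace 𝓘(ℝ, E) p) (p : M) :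
    TangentSpace 𝓘(ℝ, E) p :=
  let e := stdOrthonormalBasis ℝ (TangentSpace 𝓘(ℝ, E) p)
  ∑ a, koszul X Y (FiberBundle.extend E (e a)) p • e a

/-- `(∇_x A) y` for a (1,1)-tensor field `A`, that is `∇_X (A Y) - A (∇_X Y)` for local extensions
`X`, `Y` of `x`, `y`. -/
noncomputable def nablaEnd (A : Π p : M, TangentSpace 𝓘(ℝ, E) p →L[ℝ] TangentSpace 𝓘(ℝ, E) p)
    (p : M) (x y : TangentSpace 𝓘(ℝ, E) p) : TangentSpace 𝓘(ℝ, E) p :=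
  let X : Π q : M, TangentSpace 𝓘(ℝ, E) q := FiberBundle.extend E x
  let Y : Π q : M, TangentSpace 𝓘(ℝ, E) q := FiberBundle.extend E y
  leviCivita X (fun q ↦ A q (Y q)) p - A p (leviCivita X Y p)

/-- The Nijenhuis torsion
`[A, A](x, y) = (∇_{A x} A) y - (∇_{A y} A) x - A (∇_x A) y + A (∇_y A) x`. -/
noncomputable def nijenhuis (A : Π p : M, TangentSpace 𝓘(ℝ, E) p →L[ℝ] TangentSpace 𝓘(ℝ, E) p)
    (p : M) (x y : TangentSpace 𝓘(ℝ, E) p) : TangentSpace 𝓘(ℝ, E) p :=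
  nablaEnd A p (A p x) y - nablaEnd A p (A p y) x - A p (nablaEnd A p x y) + A p (nablaEnd A p y x)

end LeviCivita

/-! ### Complex contact structures -/

/-- The value on `x 0, …, x (2 m)` of the exterior product `θ ∧ Ω ∧ ⋯ ∧ Ω` (`m` factors `Ω`) of a
1-form and a 2-form, up to a non-zero constant factor. -/
noncomputable def wedgePow {V : Type*} {m : ℕ} (θ : V → ℂ) (Ω : V → V → ℂ)
    (x : Fin (2 * m + 1) → V) : ℂ :=
  ∑ s : Equiv.Perm (Fin (2 * m + 1)), ((Equiv.Perm.sign s : ℤ) : ℂ) *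
    (θ (x (s ⟨0, by omega⟩)) *
      ∏ k : Fin m, Ω (x (s ⟨2 * k + 1, by omega⟩)) (x (s ⟨2 * k + 2, by omega⟩)))

/-- A complex contact structure on a complex manifold `M` of complex dimension `2 m + 1`: an open
covering `𝒰` and holomorphic 1-forms `form i` on `𝒰 i` with `form i ∧ (d form i)^m ≠ 0`, which
differ by holomorphic factors on the overlaps. -/
structure ComplexContactStructure (m : ℕ) {ι : Type*} (E : Type*) [NormedAddCommGroup E]
    [NormedSpace ℂ E] {M : Type*} [TopologicalSpace M] [ChartedSpace E M]
    [IsManifold 𝓘(ℂ, E) ω M] (𝒰 : ι → Set M) where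
  finrank_eq : Module.finrank ℂ E = 2 * m + 1
  isOpen : ∀ i, IsOpen (𝒰 i)
  cover : ∀ p, ∃ i, p ∈ 𝒰 i
  form : ι → Π p : M, TangentSpace 𝓘(ℂ, E) p →L[ℂ] ℂ
  holomorphic : ∀ i, ContMDiffOn 𝓘(ℂ, E) (𝓘(ℂ, E).prod 𝓘(ℂ, E →L[ℂ] ℂ)) ω
    (fun p ↦ TotalSpace.mk' (E →L[ℂ] ℂ)
      (E := fun p : M ↦ TangentSpace 𝓘(ℂ, E) p →L[ℂ] Bundle.Trivial M ℂ p) p (form i p)) (𝒰 i)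
  contact : ∀ i, ∀ p ∈ 𝒰 i, ∃ x : Fin (2 * m + 1) → TangentSpace 𝓘(ℂ, E) p,
    wedgePow (form i p) (extDerivOneForm (form i) p) x ≠ 0
  transition : ∀ i j, ∃ h : M → ℂ, ContMDiffOn 𝓘(ℂ, E) 𝓘(ℂ) ω h (𝒰 i ∩ 𝒰 j) ∧
    ∀ p ∈ 𝒰 i ∩ 𝒰 j, form i p = h p • form j p

/-! ### Complex almost contact metric structures and normality -/

section ContactMetric

variable (m : ℕ) {ι : Type*} (E : Type*) [NormedAddCommGroup E] [NormedSpace ℂ E]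
  [FiniteDimensional ℂ E]
  {M : Type*} [TopologicalSpace M] [ChartedSpace E M] [IsManifold 𝓘(ℂ, E) ω M]
  [RiemannianBundle (fun p : M ↦ TangentSpace 𝓘(ℝ, E) p)]

/-- A complex almost contact metric structure on a complex manifold of complex dimension `2 m + 1`
with Riemannian metric `g = inner ℝ`. The forms, vector fields and tensor fields with index `i`
are local: only their values on `𝒰 i` matter. -/
structure ComplexAlmostContactMetricStructure (𝒰 : ι → Set M) where
  finrank_eq : Module.finrank ℂ E = 2 * m + 1
  isOpen : ∀ i, IsOpen (𝒰 i)
  cover : ∀ p, ∃ i, p ∈ 𝒰 i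
  /-- the metric is Hermitian -/
  hermitian : ∀ (p : M) (x y : TangentSpace 𝓘(ℝ, E) p),
    (inner ℝ (J p x) (J p y) : ℝ) = inner ℝ x y
  u : ι → Π p : M, TangentSpace 𝓘(ℝ, E) p →L[ℝ] ℝ
  v : ι → Π p : M, TangentSpace 𝓘(ℝ, E) p →L[ℝ] ℝ
  U : ι → Π p : M, TangentSpace 𝓘(ℝ, E) p
  V : ι → Π p : M, TangentSpace 𝓘(ℝ, E) p
  G : ι → Π p : M, TangentSpace 𝓘(ℝ, E) p →L[ℝ] TangentSpace 𝓘(ℝ, E) p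
  H : ι → Π p : M, TangentSpace 𝓘(ℝ, E) p →L[ℝ] TangentSpace 𝓘(ℝ, E) p
  smooth_u : ∀ i, ContMDiffOn 𝓘(ℝ, E) (𝓘(ℝ, E).prod 𝓘(ℝ, E →L[ℝ] ℝ)) ∞
    (fun p ↦ TotalSpace.mk' (E →L[ℝ] ℝ)
      (E := fun p : M ↦ TangentSpace 𝓘(ℝ, E) p →L[ℝ] Bundle.Trivial M ℝ p) p (u i p)) (𝒰 i)
  smooth_U : ∀ i, ContMDiffOn 𝓘(ℝ, E) (𝓘(ℝ, E).prod 𝓘(ℝ, E)) ∞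
    (fun p ↦ TotalSpace.mk' E (E := fun p : M ↦ TangentSpace 𝓘(ℝ, E) p) p (U i p)) (𝒰 i)
  smooth_G : ∀ i, ContMDiffOn 𝓘(ℝ, E) (𝓘(ℝ, E).prod 𝓘(ℝ, E →L[ℝ] E)) ∞
    (fun p ↦ TotalSpace.mk' (E →L[ℝ] E)
      (E := fun p : M ↦ TangentSpace 𝓘(ℝ, E) p →L[ℝ] TangentSpace 𝓘(ℝ, E) p) p (G i p)) (𝒰 i)
  v_eq : ∀ i, ∀ p ∈ 𝒰 i, v i p = (u i p).comp (J p)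
  V_eq : ∀ i, ∀ p ∈ 𝒰 i, V i p = - J p (U i p)
  H_eq : ∀ i, ∀ p ∈ 𝒰 i, H i p = (G i p).comp (J p)
  /-- `U i` is the vector field dual to `u i` -/
  u_eq : ∀ i, ∀ p ∈ 𝒰 i, ∀ x, u i p x = inner ℝ x (U i p)
  u_U : ∀ i, ∀ p ∈ 𝒰 i, u i p (U i p) = 1
  G_sq : ∀ i, ∀ p ∈ 𝒰 i, ∀ x, G i p (G i p x) = - x + u i p x • U i p + v i p x • V i p
  H_sq : ∀ i, ∀ p ∈ 𝒰 i, ∀ x, H i p (H i p x) = - x + u i p x • U i p + v i p x • V i p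
  G_J : ∀ i, ∀ p ∈ 𝒰 i, ∀ x, G i p (J p x) = - J p (G i p x)
  G_U : ∀ i, ∀ p ∈ 𝒰 i, G i p (U i p) = 0
  G_skew : ∀ i, ∀ p ∈ 𝒰 i, ∀ x y, (inner ℝ x (G i p y) : ℝ) = - inner ℝ (G i p x) y
  overlap : ∀ i j, ∀ p ∈ 𝒰 i ∩ 𝒰 j, ∃ c d : ℝ, c ^ 2 + d ^ 2 = 1 ∧
    u j p = c • u i p - d • v i p ∧ v j p = d • u i p + c • v i p ∧
    G j p = c • G i p - d • H i p ∧ H j p = d • G i p + c • H i p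

variable {m E} {𝒰 : ι → Set M}

/-- The local 1-form `σ(x) = g(∇_x U, V)`. -/
noncomputable def ComplexAlmostContactMetricStructure.σ
    (S : ComplexAlmostContactMetricStructure m E 𝒰) (i : ι) (p : M)
    (x : TangentSpace 𝓘(ℝ, E) p) : ℝ :=
  inner ℝ (leviCivita (FiberBundle.extend E x) (S.U i) p) (S.V i p)

variable (m E 𝒰) in
/-- A complex contact metric structure: a complex contact structure together with a complex almost
contact metric structure on the same covering, such that the contact form is `u - i v` up to a
non-vanishing complex valued factor, and
`du(x, y) = g(x, G y) + (σ ∧ v)(x, y)`, `dv(x, y) = g(x, H y) - (σ ∧ u)(x, y)`, where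
`(α ∧ β)(x, y) = ½ (α(x) β(y) - α(y) β(x))`, in accordance with the normalisation of `d`. -/
structure ComplexContactMetricStructure extends ComplexContactStructure m E 𝒰,
    ComplexAlmostContactMetricStructure m E 𝒰 where
  form_eq : ∀ i, ∀ p ∈ 𝒰 i, ∃ φ : ℂ, φ ≠ 0 ∧ ∀ x : TangentSpace 𝓘(ℝ, E) p,
    form i p x = φ * ((u i p x : ℂ) - Complex.I * (v i p x : ℂ))
  du_eq : ∀ i, ∀ p ∈ 𝒰 i, ∀ x y, extDerivOneForm (u i) p x y = inner ℝ x (G i p y) +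
    (1 / 2) * (toComplexAlmostContactMetricStructure.σ i p x * v i p y
      - toComplexAlmostContactMetricStructure.σ i p y * v i p x)
  dv_eq : ∀ i, ∀ p ∈ 𝒰 i, ∀ x y, extDerivOneForm (v i) p x y = inner ℝ x (H i p y) -
    (1 / 2) * (toComplexAlmostContactMetricStructure.σ i p x * u i p y
      - toComplexAlmostContactMetricStructure.σ i p y * u i p x)

namespace ComplexContactMetricStructure

variable (S : ComplexContactMetricStructure m E 𝒰)

/-- The local 1-form `σ(x) = g(∇_x U, V)`. -/
noncomputable abbrev sigma (i : ι) (p : M) (x : TangentSpace 𝓘(ℝ, E) p) : ℝ :=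
  S.toComplexAlmostContactMetricStructure.σ i p x

/-- The tensor `S` in the definition of normality. -/
noncomputable def tensorS (i : ι) (p : M) (x y : TangentSpace 𝓘(ℝ, E) p) :
    TangentSpace 𝓘(ℝ, E) p :=
  nijenhuis (S.G i) p x y
    + (2 * inner ℝ x (S.G i p y) : ℝ) • S.U i p - (2 * inner ℝ x (S.H i p y) : ℝ) • S.V i p
    + (2 : ℝ) • (S.v i p y • S.H i p x - S.v i p x • S.H i p y)
    + S.sigma i p (S.G i p y) • S.H i p x - S.sigma i p (S.G i p x) • S.H i p y
    + S.sigma i p x • S.G i p (S.H i p y) - S.sigma i p y • S.G i p (S.H i p x)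

/-- The tensor `T` in the definition of normality. -/
noncomputable def tensorT (i : ι) (p : M) (x y : TangentSpace 𝓘(ℝ, E) p) :
    TangentSpace 𝓘(ℝ, E) p :=
  nijenhuis (S.H i) p x y
    - (2 * inner ℝ x (S.G i p y) : ℝ) • S.U i p + (2 * inner ℝ x (S.H i p y) : ℝ) • S.V i p
    + (2 : ℝ) • (S.u i p y • S.G i p x - S.u i p x • S.G i p y)
    + S.sigma i p (S.H i p x) • S.G i p y - S.sigma i p (S.H i p y) • S.G i p x
    + S.sigma i p x • S.G i p (S.H i p y) - S.sigma i p y • S.G i p (S.H i p x)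

/-- Normality: `S` and `T` vanish on the horizontal subbundle, the kernel of the contact form, and
`S(x, U) = T(x, V) = 0` for all `x`. -/
structure IsNormal : Prop where
  horizontal : ∀ i, ∀ p ∈ 𝒰 i, ∀ x y : TangentSpace 𝓘(ℝ, E) p,
    S.form i p x = 0 → S.form i p y = 0 → S.tensorS i p x y = 0 ∧ S.tensorT i p x y = 0
  vertical : ∀ i, ∀ p ∈ 𝒰 i, ∀ x : TangentSpace 𝓘(ℝ, E) p,
    S.tensorS i p x (S.U i p) = 0 ∧ S.tensorT i p x (S.V i p) = 0

end ComplexContactMetricStructure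

end ContactMetric

/-! ### Distributions -/

section Distributions

variable {E : Type*} [NormedAddCommGroup E] [NormedSpace ℝ E]
  {M : Type*} [TopologicalSpace M] [ChartedSpace E M] [IsManifold 𝓘(ℝ, E) 1 M]

/-- `X` is a smooth section, over the set `W`, of the distribution `D`. -/
structure IsSmoothSectionOn (D : Π p : M, Submodule ℝ (TangentSpace 𝓘(ℝ, E) p)) (W : Set M)
    (X : Π p : M, TangentSpace 𝓘(ℝ, E) p) : Prop where
  smooth : ContMDiffOn 𝓘(ℝ, E) (𝓘(ℝ, E).prod 𝓘(ℝ, E)) ∞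
    (fun p ↦ TotalSpace.mk' E (E := fun p : M ↦ TangentSpace 𝓘(ℝ, E) p) p (X p)) W
  mem : ∀ p ∈ W, X p ∈ D p

/-- `D` has constant dimension and is differentiable: each vector of `D p` is the value at `p` of
a smooth section of `D` defined near `p`. -/
structure IsDistribution (D : Π p : M, Submodule ℝ (TangentSpace 𝓘(ℝ, E) p)) : Prop where
  const_rank : ∃ r : ℕ, ∀ p, Module.finrank ℝ (D p) = r
  smooth : ∀ p, ∀ x ∈ D p, ∃ W : Set M, IsOpen W ∧ p ∈ W ∧
    ∃ X : Π q : M, TangentSpace 𝓘(ℝ, E) q, IsSmoothSectionOn D W X ∧ X p = x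

/-- `D` is involutive: the bracket of two sections of `D` is a section of `D`. -/
def IsInvolutive (D : Π p : M, Submodule ℝ (TangentSpace 𝓘(ℝ, E) p)) : Prop :=
  ∀ X Y : Π p : M, TangentSpace 𝓘(ℝ, E) p,
    IsSmoothSectionOn D Set.univ X → IsSmoothSectionOn D Set.univ Y →
    ∀ p, VectorField.mlieBracket 𝓘(ℝ, E) X Y p ∈ D p

end Distributions

/-! ### Semi-invariant submanifolds -/

/-- A holomorphic immersion `f : M → N` of complex manifolds: `M` is a complex submanifold of `N`,
with tangent space at `p` the range of the differential of `f` at `p`. -/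
structure IsHolomorphicImmersion {E F : Type*} [NormedAddCommGroup E] [NormedSpace ℂ E]
    [NormedAddCommGroup F] [NormedSpace ℂ F] {M N : Type*} [TopologicalSpace M] [ChartedSpace E M]
    [TopologicalSpace N] [ChartedSpace F N] (f : M → N) : Prop where
  holomorphic : ContMDiff 𝓘(ℂ, E) 𝓘(ℂ, F) ω f
  injective : ∀ p, Function.Injective (mfderiv 𝓘(ℂ, E) 𝓘(ℂ, F) f p)

namespace ComplexContactMetricStructure

variable {m : ℕ} {ι : Type*} {E F : Type*} [NormedAddCommGroup E] [NormedSpace ℂ E]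
  [NormedAddCommGroup F] [NormedSpace ℂ F] [FiniteDimensional ℂ F]
  {M : Type*} [TopologicalSpace M] [ChartedSpace E M]
  {N : Type*} [TopologicalSpace N] [ChartedSpace F N] [IsManifold 𝓘(ℂ, F) ω N]
  [RiemannianBundle (fun p : N ↦ TangentSpace 𝓘(ℝ, F) p)] {𝒰 : ι → Set N}

/-- The image of the tangent space of `M` in the tangent space of the ambient manifold. -/
noncomputable def tangentImage (f : M → N) (p : M) : Submodule ℝ (TangentSpace 𝓘(ℝ, F) (f p)) :=
  (mfderiv 𝓘(ℝ, E) 𝓘(ℝ, F) f p).range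

variable (S : ComplexContactMetricStructure m F 𝒰) (f : M → N)

/-- The tangential part `P x` of `G x`, for `x` tangent to `M`. -/
noncomputable def P (i : ι) (p : M) :
    TangentSpace 𝓘(ℝ, E) p →L[ℝ] TangentSpace 𝓘(ℝ, F) (f p) :=
  ((tangentImage (E := E) f p).starProjection.comp (S.G i (f p))).comp
    (mfderiv 𝓘(ℝ, E) 𝓘(ℝ, F) f p)

/-- The normal part `Q x` of `G x`, for `x` tangent to `M`. -/
noncomputable def Q (i : ι) (p : M) :
    TangentSpace 𝓘(ℝ, E) p →L[ℝ] TangentSpace 𝓘(ℝ, F) (f p) :=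
  ((tangentImage (E := E) f p)ᗮ.starProjection.comp (S.G i (f p))).comp
    (mfderiv 𝓘(ℝ, E) 𝓘(ℝ, F) f p)

/-- The orthogonal complement of `sp{U, V}` in the tangent space of `M`. -/
noncomputable def orthUV (i : ι) (p : M) : Submodule ℝ (TangentSpace 𝓘(ℝ, E) p) :=
  (Submodule.span ℝ {S.U i (f p), S.V i (f p)})ᗮ.comap
    (mfderiv 𝓘(ℝ, E) 𝓘(ℝ, F) f p).toLinearMap

/-- The invariant distribution `D_p = {x ⟂ sp{U, V} : Q x = 0}` of `M`. (The condition is the same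
for all indices `i` with `f p ∈ 𝒰 i`.) -/
noncomputable def invDist (p : M) : Submodule ℝ (TangentSpace 𝓘(ℝ, E) p) :=
  ⨅ (i : ι) (_ : f p ∈ 𝒰 i), S.orthUV f i p ⊓ (S.Q f i p).ker

/-- The anti-invariant distribution `{x ⟂ sp{U, V} : P x = 0}` of `M`. (The condition is the same
for all indices `i` with `f p ∈ 𝒰 i`.) -/
noncomputable def antiInvDist (p : M) : Submodule ℝ (TangentSpace 𝓘(ℝ, E) p) :=
  ⨅ (i : ι) (_ : f p ∈ 𝒰 i), S.orthUV f i p ⊓ (S.P f i p).ker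

/-- `M`, immersed by `f`, is a semi-invariant submanifold: it is a complex submanifold tangent to
`U` and `V`, and the invariant and the anti-invariant distributions have constant dimension and
are differentiable. -/
structure IsSemiInvariant [IsManifold 𝓘(ℂ, E) ω M] : Prop where
  immersion : IsHolomorphicImmersion (E := E) (F := F) f
  U_tangent : ∀ i p, f p ∈ 𝒰 i → S.U i (f p) ∈ tangentImage (E := E) f p
  V_tangent : ∀ i p, f p ∈ 𝒰 i → S.V i (f p) ∈ tangentImage (E := E) f p
  invDist : IsDistribution (S.invDist (E := E) f)
  antiInvDist : IsDistribution (S.antiInvDist (E := E) f)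

end ComplexContactMetricStructure

end ComplexContact

/-! The forms `u` and `v` are dual to `U` and `V`, so both annihilate the invariant distribution. If
a 1-form `θ` vanishes on two vector fields near a point, the derivative terms of `dθ` drop out and
`θ([K, L]) = -2 dθ(K, L)`. For `θ = u` the term `σ ∧ v` of `du` vanishes because `v(K) = v(L) = 0`,
which leaves `-2 g(K, G L) = 2 g(G K, L)`; `v` and `H` behave in the same way.

For non-involutivity take `K ≠ 0` at `p` and `L = G K`. The distribution is stable under `G`: `G K`
is tangent to `M`, it is orthogonal to `U` and `V`, and `G (G K) = -K` is again tangent. Then `g([K,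
L], U) = 2 |G K|² ≠ 0`, since `G² = -1` on the complement of `U, V` makes `G` injective there.

The analytic work comes from `M` being only immersed: brackets are taken on `M`, whereas `u` and `v`
live on the ambient manifold. The exterior derivative must therefore commute with pullback.
`mvfderiv_pullback_sub` proves this in charts, and `apply_mlieBracket_of_eventually_apply_eq_zero`
is the form used. The algebra is carried by `exists_mem_invDist_mfderiv_eq_G`, the passage to global
sections by a bump function. -/

namespace ComplexContact

/-! ### Pullbacks of 1-forms and brackets in charts -/

section Real

variable {E F : Type*} [NormedAddCommGroup E] [NormedSpace ℝ E] [NormedAddCommGroup F]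
  [NormedSpace ℝ F]

/-- The product rule splits the derivative of `θ(g)(Dg X)` into a `Dθ` term and `θ` applied to the
derivative of `Dg X`. After antisymmetrisation the latter terms give `θ(Dg [K, L])`, because the
second derivative of `g` is symmetric. -/
theorem fderiv_clm_pullback_sub {g : E → F} {θ : F → F →L[ℝ] ℝ} {K L : E → E} {x : E}
    (hg : ContDiffAt ℝ 2 g x) (hθ : DifferentiableAt ℝ θ (g x)) (hK : DifferentiableAt ℝ K x)
    (hL : DifferentiableAt ℝ L x) :
    fderiv ℝ (fun e ↦ θ (g e) (fderiv ℝ g e (L e))) x (K x)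
      - fderiv ℝ (fun e ↦ θ (g e) (fderiv ℝ g e (K e))) x (L x)
      - θ (g x) (fderiv ℝ g x (VectorField.lieBracket ℝ K L x)) =
    fderiv ℝ θ (g x) (fderiv ℝ g x (K x)) (fderiv ℝ g x (L x))
      - fderiv ℝ θ (g x) (fderiv ℝ g x (L x)) (fderiv ℝ g x (K x)) := by
  have hg1 : DifferentiableAt ℝ g x := hg.differentiableAt (by norm_num)
  have hg2 : DifferentiableAt ℝ (fderiv ℝ g) x :=
    (hg.fderiv_right (m := 1) (by norm_num)).differentiableAt (by norm_num)
  have key : ∀ X : E → E, DifferentiableAt ℝ X x → ∀ v,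
      fderiv ℝ (fun e ↦ θ (g e) (fderiv ℝ g e (X e))) x v =
        fderiv ℝ θ (g x) (fderiv ℝ g x v) (fderiv ℝ g x (X x))
          + θ (g x) (fderiv ℝ (fun e ↦ fderiv ℝ g e (X e)) x v) := by
    intro X hX v
    have h1 : HasFDerivAt (fun e ↦ θ (g e)) ((fderiv ℝ θ (g x)).comp (fderiv ℝ g x)) x :=
      hθ.hasFDerivAt.comp x hg1.hasFDerivAt
    have h2 := (hg2.clm_apply hX).hasFDerivAt
    rw [(h1.clm_apply h2).fderiv]
    simp [add_comm]
  rw [key K hK, key L hL, VectorField.fderiv_apply_lieBracket hg (by simp) hL hK, map_sub]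
  ring

variable {M : Type*} [TopologicalSpace M] [ChartedSpace E M] [IsManifold 𝓘(ℝ, E) ω M]
  {N : Type*} [TopologicalSpace N] [ChartedSpace F N] [IsManifold 𝓘(ℝ, F) ω N]

/-- A 1-form read in the preferred chart at `p`. -/
noncomputable def chartForm (θ : Π p : M, TangentSpace 𝓘(ℝ, E) p →L[ℝ] ℝ) (p : M) :
    E → E →L[ℝ] ℝ :=
  fun y ↦ (θ ((extChartAt 𝓘(ℝ, E) p).symm y)).comp
    (mfderiv 𝓘(ℝ, E) 𝓘(ℝ, E) (extChartAt 𝓘(ℝ, E) p).symm y)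

/-- A vector field read in the preferred chart at `p`. -/
noncomputable def chartField (K : Π p : M, TangentSpace 𝓘(ℝ, E) p) (p : M) : E → E :=
  VectorField.mpullbackWithin 𝓘(ℝ, E) 𝓘(ℝ, E) (extChartAt 𝓘(ℝ, E) p).symm K
    (Set.range 𝓘(ℝ, E))

theorem mdifferentiableAt_extChartAt_symm_self (p : M) :
    MDifferentiableAt 𝓘(ℝ, E) 𝓘(ℝ, E) (extChartAt 𝓘(ℝ, E) p).symm (extChartAt 𝓘(ℝ, E) p p) := by
  have := mdifferentiableWithinAt_extChartAt_symm (I := 𝓘(ℝ, E))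
    (mem_extChartAt_target (I := 𝓘(ℝ, E)) p)
  rwa [modelWithCornersSelf_coe, Set.range_id, mdifferentiableWithinAt_univ] at this

/-- The trivialisation of the cotangent bundle reads `θ` through the inverse of the tangent
trivialisation, which is the derivative of the inverse chart. Hence `chartForm` is the coordinate
expression of the section, composed with the inverse chart. -/
theorem differentiableAt_chartForm {θ : Π p : M, TangentSpace 𝓘(ℝ, E) p →L[ℝ] ℝ} {p : M}
    (hθ : MDifferentiableAt 𝓘(ℝ, E) (𝓘(ℝ, E).prod 𝓘(ℝ, E →L[ℝ] ℝ))
      (fun p ↦ TotalSpace.mk' (E →L[ℝ] ℝ)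
        (E := fun p : M ↦ TangentSpace 𝓘(ℝ, E) p →L[ℝ] Bundle.Trivial M ℝ p) p (θ p)) p) :
    DifferentiableAt ℝ (chartForm θ p) (extChartAt 𝓘(ℝ, E) p p) := by
  rw [mdifferentiableAt_hom_bundle] at hθ
  have h := hθ.2
  have hp : (extChartAt 𝓘(ℝ, E) p).symm (extChartAt 𝓘(ℝ, E) p p) = p := extChartAt_to_inv p
  have h2 := MDifferentiableAt.comp_of_eq (x := extChartAt 𝓘(ℝ, E) p p) (hg := h)
    (hf := mdifferentiableAt_extChartAt_symm_self p) (hy := hp)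
  rw [← mdifferentiableAt_iff_differentiableAt]
  refine h2.congr_of_eventuallyEq ?_
  filter_upwards [extChartAt_target_mem_nhds (I := 𝓘(ℝ, E)) p] with y hy
  have hy' : (extChartAt 𝓘(ℝ, E) p).symm y ∈ (chartAt E p).source := by
    simpa using (extChartAt 𝓘(ℝ, E) p).map_target hy
  have hb : (extChartAt 𝓘(ℝ, E) p).symm y ∈
    (trivializationAt E (TangentSpace 𝓘(ℝ, E)) p).baseSet := by simpa using hy'
  have := TangentBundle.symmL_trivializationAt (I := 𝓘(ℝ, E)) hy'
  rw [(extChartAt 𝓘(ℝ, E) p).right_inv hy] at this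
  simp only [modelWithCornersSelf_coe, Set.range_id, mfderivWithin_univ] at this
  ext v
  simp only [Function.comp_apply, chartForm, ← this]
  rw [ContinuousLinearMap.inCoordinates_eq hb (by simp)]
  exact congrArg (θ _) (congrFun
    ((trivializationAt E (TangentSpace 𝓘(ℝ, E)) p).symm_continuousLinearEquivAt_eq
      (R := ℝ) hb) v).symm

theorem differentiableAt_chartField [CompleteSpace E] {K : Π p : M, TangentSpace 𝓘(ℝ, E) p} {p : M}
    (hK : MDifferentiableAt 𝓘(ℝ, E) (𝓘(ℝ, E).prod 𝓘(ℝ, E))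
      (fun p ↦ TotalSpace.mk' E (E := fun p : M ↦ TangentSpace 𝓘(ℝ, E) p) p (K p)) p) :
    DifferentiableAt ℝ (chartField K p) (extChartAt 𝓘(ℝ, E) p p) := by
  have : IsManifold 𝓘(ℝ, E) 2 M := IsManifold.of_le (n := ω) le_top
  have h := (mdifferentiableWithinAt_univ.2 hK).differentiableWithinAt_mpullbackWithin_vectorField
  refine h.differentiableAt ?_
  simp

/-- The tangent space at `p` is read in the preferred chart at `p`, so the derivative of this chart
at `p` is the identity and transporting the bracket back to `M` changes nothing. -/
theorem mlieBracket_eq_lieBracket_chartField (K L : Π p : M, TangentSpace 𝓘(ℝ, E) p) (p : M) :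
    VectorField.mlieBracket 𝓘(ℝ, E) K L p =
      VectorField.lieBracket ℝ (chartField K p) (chartField L p) (extChartAt 𝓘(ℝ, E) p p) := by
  have h : VectorField.lieBracketWithin ℝ (chartField K p) (chartField L p)
      ((extChartAt 𝓘(ℝ, E) p).symm ⁻¹' Set.univ ∩ Set.range 𝓘(ℝ, E)) (extChartAt 𝓘(ℝ, E) p p) =
      VectorField.lieBracket ℝ (chartField K p) (chartField L p) (extChartAt 𝓘(ℝ, E) p p) := by
    rw [Set.preimage_univ, Set.univ_inter, modelWithCornersSelf_coe, Set.range_id,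
      VectorField.lieBracketWithin_univ]
  refine Eq.trans ?_ h
  exact (congrArg (fun A : E →L[ℝ] E ↦ A.inverse (VectorField.lieBracketWithin ℝ (chartField K p)
    (chartField L p) ((extChartAt 𝓘(ℝ, E) p).symm ⁻¹' Set.univ ∩ Set.range 𝓘(ℝ, E))
    (extChartAt 𝓘(ℝ, E) p p))) (mfderiv_extChartAt_self (I := 𝓘(ℝ, E)) (x := p))).trans
    (congrArg (fun A : E →L[ℝ] E ↦ A _) ContinuousLinearMap.inverse_id)

theorem mfderiv_extChartAt_symm_self (p : M) :
    mfderiv 𝓘(ℝ, E) 𝓘(ℝ, E) (extChartAt 𝓘(ℝ, E) p).symm (extChartAt 𝓘(ℝ, E) p p) =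
      ContinuousLinearMap.id ℝ E := by
  have := mfderivWithin_range_extChartAt_symm (I := 𝓘(ℝ, E)) (x := p)
  rw [modelWithCornersSelf_coe, Set.range_id, mfderivWithin_univ] at this
  exact this

theorem chartField_extChartAt_self (K : Π p : M, TangentSpace 𝓘(ℝ, E) p) (p : M) :
    chartField K p (extChartAt 𝓘(ℝ, E) p p) = K p := by
  have h1 : chartField K p (extChartAt 𝓘(ℝ, E) p p) =
      ContinuousLinearMap.inverse (ContinuousLinearMap.id ℝ E)
        (K ((extChartAt 𝓘(ℝ, E) p).symm (extChartAt 𝓘(ℝ, E) p p))) :=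
    congrArg (fun A : E →L[ℝ] E ↦
      A.inverse (K ((extChartAt 𝓘(ℝ, E) p).symm (extChartAt 𝓘(ℝ, E) p p))))
      (mfderivWithin_range_extChartAt_symm (I := 𝓘(ℝ, E)) (x := p))
  -- The base point is `p` only up to a propositional equality, so the values are compared in the
  -- model space with the point generalised.
  have h2 : ∀ q, q = p → (K q : E) = K p := by rintro q rfl; rfl
  rw [h1, ContinuousLinearMap.inverse_id]
  exact h2 _ (extChartAt_to_inv p)

theorem chartForm_extChartAt_self (θ : Π p : M, TangentSpace 𝓘(ℝ, E) p →L[ℝ] ℝ) (p : M) :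
    chartForm θ p (extChartAt 𝓘(ℝ, E) p p) = θ p := by
  have h1 : chartForm θ p (extChartAt 𝓘(ℝ, E) p p) =
      (θ ((extChartAt 𝓘(ℝ, E) p).symm (extChartAt 𝓘(ℝ, E) p p)) : E →L[ℝ] ℝ).comp
        (ContinuousLinearMap.id ℝ E) :=
    congrArg (fun A : E →L[ℝ] E ↦
      (θ ((extChartAt 𝓘(ℝ, E) p).symm (extChartAt 𝓘(ℝ, E) p p)) : E →L[ℝ] ℝ).comp A)
      (mfderiv_extChartAt_symm_self p)
  have h2 : ∀ q, q = p → (θ q : E →L[ℝ] ℝ) = θ p := by rintro q rfl; rfl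
  exact h1.trans ((ContinuousLinearMap.comp_id _).trans (h2 _ (extChartAt_to_inv p)))

/-- The pullback of a 1-form, evaluated on a vector field, in charts. -/
theorem pullback_apply_eventuallyEq_chart (θ : Π p : N, TangentSpace 𝓘(ℝ, F) p →L[ℝ] ℝ)
    {f : M → N} {p : M} (hf : ContMDiffAt 𝓘(ℝ, E) 𝓘(ℝ, F) 2 f p)
    (K : Π p : M, TangentSpace 𝓘(ℝ, E) p) :
    (fun e ↦ θ (f ((extChartAt 𝓘(ℝ, E) p).symm e)) (mfderiv 𝓘(ℝ, E) 𝓘(ℝ, F) f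
        ((extChartAt 𝓘(ℝ, E) p).symm e) (K ((extChartAt 𝓘(ℝ, E) p).symm e))))
      =ᶠ[𝓝 (extChartAt 𝓘(ℝ, E) p p)]
    fun e ↦ chartForm θ (f p) (writtenInExtChartAt 𝓘(ℝ, E) 𝓘(ℝ, F) p f e)
      (fderiv ℝ (writtenInExtChartAt 𝓘(ℝ, E) 𝓘(ℝ, F) p f) e (chartField K p e)) := by
  set φ := extChartAt 𝓘(ℝ, E) p with hφ
  set ψ := extChartAt 𝓘(ℝ, F) (f p) with hψ
  set g : E → F := writtenInExtChartAt 𝓘(ℝ, E) 𝓘(ℝ, F) p f with hg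
  have hφc : Filter.Tendsto φ.symm (𝓝 (φ p)) (𝓝 p) := by
    have := continuousAt_extChartAt_symm (I := 𝓘(ℝ, E)) p
    rwa [ContinuousAt, extChartAt_to_inv] at this
  have hs : ∀ᶠ e in 𝓝 (φ p), f (φ.symm e) ∈ ψ.source :=
    hφc.eventually (hf.continuousAt.eventually (extChartAt_source_mem_nhds (I := 𝓘(ℝ, F)) (f p)))
  have hfd : ∀ᶠ e in 𝓝 (φ p), MDifferentiableAt 𝓘(ℝ, E) 𝓘(ℝ, F) f (φ.symm e) :=
    hφc.eventually (((contMDiffAt_iff_contMDiffAt_nhds (by simp)).1 hf).mono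
      fun q hq ↦ hq.mdifferentiableAt (by norm_num))
  -- The identity `ψ.symm ∘ g = f ∘ φ.symm` is going to be differentiated at `e`, so it is needed on
  -- a neighbourhood of `e`.
  filter_upwards [extChartAt_target_mem_nhds (I := 𝓘(ℝ, E)) p, eventually_eventually_nhds.2 hs, hfd]
    with e he hse hfe
  have hse' := hse.self_of_nhds
  have hge : ψ.symm (g e) = f (φ.symm e) := ψ.left_inv hse'
  have hφe : MDifferentiableAt 𝓘(ℝ, E) 𝓘(ℝ, E) φ.symm e := by
    have := mdifferentiableWithinAt_extChartAt_symm (I := 𝓘(ℝ, E)) he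
    rwa [modelWithCornersSelf_coe, Set.range_id, mdifferentiableWithinAt_univ] at this
  have hψe : MDifferentiableAt 𝓘(ℝ, F) 𝓘(ℝ, F) ψ.symm (g e) := by
    have := mdifferentiableWithinAt_extChartAt_symm (I := 𝓘(ℝ, F)) (ψ.map_source hse')
    rwa [modelWithCornersSelf_coe, Set.range_id, mdifferentiableWithinAt_univ] at this
  have hψd : MDifferentiableAt 𝓘(ℝ, F) 𝓘(ℝ, F) ψ (f (φ.symm e)) :=
    mdifferentiableAt_extChartAt (by simpa [hψ] using hse')
  have hcomp : MDifferentiableAt 𝓘(ℝ, E) 𝓘(ℝ, F) (f ∘ φ.symm) e := hfe.comp e hφe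
  have hgd : MDifferentiableAt 𝓘(ℝ, E) 𝓘(ℝ, F) g e := hψd.comp e hcomp
  have hev : ψ.symm ∘ g =ᶠ[𝓝 e] f ∘ φ.symm := hse.mono fun y hy ↦ ψ.left_inv hy
  have h1 : (mfderiv 𝓘(ℝ, E) 𝓘(ℝ, F) (ψ.symm ∘ g) e : E →L[ℝ] F) =
      mfderiv 𝓘(ℝ, E) 𝓘(ℝ, F) (f ∘ φ.symm) e := hev.mfderiv_eq
  have h2 : (mfderiv 𝓘(ℝ, E) 𝓘(ℝ, F) (ψ.symm ∘ g) e : E →L[ℝ] F) =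
      (mfderiv 𝓘(ℝ, F) 𝓘(ℝ, F) ψ.symm (g e) : F →L[ℝ] F).comp (fderiv ℝ g e) :=
    (mfderiv_comp e hψe hgd).trans (congrArg (fun A : E →L[ℝ] F ↦
      (mfderiv 𝓘(ℝ, F) 𝓘(ℝ, F) ψ.symm (g e) : F →L[ℝ] F).comp A) mfderiv_eq_fderiv)
  have h3 : (mfderiv 𝓘(ℝ, E) 𝓘(ℝ, F) (f ∘ φ.symm) e : E →L[ℝ] F) =
      (mfderiv 𝓘(ℝ, E) 𝓘(ℝ, F) f (φ.symm e) : E →L[ℝ] F).comp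
        (mfderiv 𝓘(ℝ, E) 𝓘(ℝ, E) φ.symm e : E →L[ℝ] E) := mfderiv_comp e hfe hφe
  -- `chartField` applies the inverse of the derivative of `φ.symm`, which is invertible on the
  -- target of the chart; the two cancel.
  have h4 : (mfderiv 𝓘(ℝ, E) 𝓘(ℝ, E) φ.symm e : E →L[ℝ] E) (chartField (E := E) K p e) =
      K (φ.symm e) := by
    have hinv := isInvertible_mfderivWithin_extChartAt_symm (I := 𝓘(ℝ, E)) he
    have := hinv.self_apply_inverse (K (φ.symm e))
    have hw : (mfderivWithin 𝓘(ℝ, E) 𝓘(ℝ, E) φ.symm (Set.range 𝓘(ℝ, E)) e) =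
      mfderiv 𝓘(ℝ, E) 𝓘(ℝ, E) φ.symm e := by
      rw [modelWithCornersSelf_coe, Set.range_id, mfderivWithin_univ]
    exact (congrArg (fun A : E →L[ℝ] E ↦ A (chartField K p e)) hw).symm.trans this
  have hθ : ∀ q q' : N, q = q' → ∀ w : F, (θ q : F →L[ℝ] ℝ) w = (θ q' : F →L[ℝ] ℝ) w := by
    rintro q _ rfl w
    rfl
  have h5 := congrArg (fun A : E →L[ℝ] F ↦ A (chartField K p e)) (h2.symm.trans (h1.trans h3))
  refine Eq.trans ?_ (hθ _ _ hge _).symm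
  refine congrArg (θ (f (φ.symm e)) : F →L[ℝ] ℝ) ?_
  exact (h5.trans (congrArg (mfderiv 𝓘(ℝ, E) 𝓘(ℝ, F) f (φ.symm e) : E →L[ℝ] F) h4)).symm

/-- The right side involves only the values of `K` and `L` at `p`, pushed forward by `f`. The
expression is thus tensorial, and the cases of `f` and of the identity can be compared. -/
theorem mvfderiv_pullback_sub [CompleteSpace E] {θ : Π p : N, TangentSpace 𝓘(ℝ, F) p →L[ℝ] ℝ}
    {f : M → N} {p : M} (hf : ContMDiffAt 𝓘(ℝ, E) 𝓘(ℝ, F) 2 f p)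
    (hθ : DifferentiableAt ℝ (chartForm θ (f p)) (extChartAt 𝓘(ℝ, F) (f p) (f p)))
    {K L : Π p : M, TangentSpace 𝓘(ℝ, E) p}
    (hK : MDifferentiableAt 𝓘(ℝ, E) (𝓘(ℝ, E).prod 𝓘(ℝ, E))
      (fun p ↦ TotalSpace.mk' E (E := fun p : M ↦ TangentSpace 𝓘(ℝ, E) p) p (K p)) p)
    (hL : MDifferentiableAt 𝓘(ℝ, E) (𝓘(ℝ, E).prod 𝓘(ℝ, E))
      (fun p ↦ TotalSpace.mk' E (E := fun p : M ↦ TangentSpace 𝓘(ℝ, E) p) p (L p)) p) :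
    mvfderiv 𝓘(ℝ, E) (fun q ↦ θ (f q) (mfderiv 𝓘(ℝ, E) 𝓘(ℝ, F) f q (L q))) p (K p)
      - mvfderiv 𝓘(ℝ, E) (fun q ↦ θ (f q) (mfderiv 𝓘(ℝ, E) 𝓘(ℝ, F) f q (K q))) p (L p)
      - θ (f p) (mfderiv 𝓘(ℝ, E) 𝓘(ℝ, F) f p (VectorField.mlieBracket 𝓘(ℝ, E) K L p)) =
    fderiv ℝ (chartForm θ (f p)) (extChartAt 𝓘(ℝ, F) (f p) (f p))
        (mfderiv 𝓘(ℝ, E) 𝓘(ℝ, F) f p (K p)) (mfderiv 𝓘(ℝ, E) 𝓘(ℝ, F) f p (L p))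
      - fderiv ℝ (chartForm θ (f p)) (extChartAt 𝓘(ℝ, F) (f p) (f p))
        (mfderiv 𝓘(ℝ, E) 𝓘(ℝ, F) f p (L p)) (mfderiv 𝓘(ℝ, E) 𝓘(ℝ, F) f p (K p)) := by
  set g : E → F := writtenInExtChartAt 𝓘(ℝ, E) 𝓘(ℝ, F) p f with hg_def
  set x : E := extChartAt 𝓘(ℝ, E) p p with hx
  have hxp : (extChartAt 𝓘(ℝ, E) p).symm x = p := extChartAt_to_inv p
  have hgx : g x = extChartAt 𝓘(ℝ, F) (f p) (f p) := by
    rw [hg_def, writtenInExtChartAt, Function.comp_apply, Function.comp_apply, hxp]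
  have hg : ContDiffAt ℝ 2 g x := by
    have := ((contMDiffAt_iff).1 hf).2
    rwa [modelWithCornersSelf_coe, Set.range_id, contDiffWithinAt_univ] at this
  have hdf : (mfderiv 𝓘(ℝ, E) 𝓘(ℝ, F) f p : E →L[ℝ] F) = fderiv ℝ g x := by
    rw [(hf.mdifferentiableAt (by norm_num)).mfderiv, modelWithCornersSelf_coe, Set.range_id,
      fderivWithin_univ]
  rw [← hgx] at hθ
  -- Near `p` the function is a coordinate function composed with the chart, whose derivative at `p`
  -- is the identity.
  have key : ∀ X : Π p : M, TangentSpace 𝓘(ℝ, E) p,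
      MDifferentiableAt 𝓘(ℝ, E) (𝓘(ℝ, E).prod 𝓘(ℝ, E))
      (fun p ↦ TotalSpace.mk' E (E := fun p : M ↦ TangentSpace 𝓘(ℝ, E) p) p (X p)) p → ∀ v : E,
      mvfderiv 𝓘(ℝ, E) (fun q ↦ θ (f q) (mfderiv 𝓘(ℝ, E) 𝓘(ℝ, F) f q (X q))) p v =
        fderiv ℝ (fun e ↦ chartForm θ (f p) (g e) (fderiv ℝ g e (chartField X p e))) x v := by
    intro X hX v
    set h : E → ℝ := fun e ↦ chartForm θ (f p) (g e) (fderiv ℝ g e (chartField X p e)) with hh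
    have hd : DifferentiableAt ℝ h x :=
      (hθ.comp x (hg.differentiableAt (by norm_num))).clm_apply
        (((hg.fderiv_right (m := 1) (by norm_num)).differentiableAt (by norm_num)).clm_apply
          (differentiableAt_chartField hX))
    have h1 : HasMFDerivAt 𝓘(ℝ, E) 𝓘(ℝ, ℝ) (h ∘ extChartAt 𝓘(ℝ, E) p) p
        ((fderiv ℝ h x).comp (mfderiv 𝓘(ℝ, E) 𝓘(ℝ, E) (extChartAt 𝓘(ℝ, E) p) p)) :=
      HasMFDerivAt.comp p hd.hasFDerivAt.hasMFDerivAt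
        (mdifferentiableAt_extChartAt (mem_chart_source E p)).hasMFDerivAt
    have h2 : (fun q ↦ θ (f q) (mfderiv 𝓘(ℝ, E) 𝓘(ℝ, F) f q (X q))) =ᶠ[𝓝 p]
        h ∘ extChartAt 𝓘(ℝ, E) p := by
      have := (continuousAt_extChartAt (I := 𝓘(ℝ, E)) p).eventually
        (pullback_apply_eventuallyEq_chart θ hf X)
      filter_upwards [this, extChartAt_source_mem_nhds (I := 𝓘(ℝ, E)) p] with q hq hq'
      rw [(extChartAt 𝓘(ℝ, E) p).left_inv hq'] at hq
      exact hq
    have h3 := (h1.congr_of_eventuallyEq h2).mfderiv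
    have h4 : (mfderiv 𝓘(ℝ, E) 𝓘(ℝ, E) (extChartAt 𝓘(ℝ, E) p) p : E →L[ℝ] E) v = v :=
      congrArg (fun A : E →L[ℝ] E ↦ A v) (mfderiv_extChartAt_self (I := 𝓘(ℝ, E)) (x := p))
    refine (congrArg (fun A : E →L[ℝ] ℝ ↦ A v) h3).trans ?_
    exact congrArg (fderiv ℝ h x) h4
  have := fderiv_clm_pullback_sub hg hθ (differentiableAt_chartField hK)
    (differentiableAt_chartField hL)
  rw [chartField_extChartAt_self, chartField_extChartAt_self, ← mlieBracket_eq_lieBracket_chartField,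
    ← hdf, hgx, chartForm_extChartAt_self] at this
  refine Eq.trans ?_ this
  exact congrArg₂ (· - ·) (congrArg₂ (· - ·) (key L hL _) (key K hK _)) rfl

end Real
-- The exterior derivative and its naturality
section Real

variable {E F : Type*} [NormedAddCommGroup E] [NormedSpace ℝ E] [NormedAddCommGroup F]
  [NormedSpace ℝ F] [CompleteSpace E] [CompleteSpace F]
  {M : Type*} [TopologicalSpace M] [ChartedSpace E M] [IsManifold 𝓘(ℝ, E) ω M]
  {N : Type*} [TopologicalSpace N] [ChartedSpace F N] [IsManifold 𝓘(ℝ, F) ω N]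

/-- This is the case `f = id` of `mvfderiv_pullback_sub`, applied to the local extensions of `x` and
`y`; it removes the dependence on their choice. -/
theorem extDerivOneForm_eq_fderiv_chartForm {θ : Π p : N, TangentSpace 𝓘(ℝ, F) p →L[ℝ] ℝ} {p : N}
    (hθ : DifferentiableAt ℝ (chartForm θ p) (extChartAt 𝓘(ℝ, F) p p))
    (x y : TangentSpace 𝓘(ℝ, F) p) :
    extDerivOneForm θ p x y =
      (1 / 2) * (fderiv ℝ (chartForm θ p) (extChartAt 𝓘(ℝ, F) p p) x y
        - fderiv ℝ (chartForm θ p) (extChartAt 𝓘(ℝ, F) p p) y x) := by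
  have key := mvfderiv_pullback_sub (f := id) (p := p) contMDiffAt_id hθ
    (FiberBundle.mdifferentiableAt_extend 𝓘(ℝ, F) F x)
    (FiberBundle.mdifferentiableAt_extend 𝓘(ℝ, F) F y)
  simp only [mfderiv_id, id_eq, FiberBundle.extend_apply_self] at key
  rw [extDerivOneForm]
  exact congrArg _ key

/-- The exterior derivative commutes with pullbacks. -/
theorem extDerivOneForm_pullback {θ : Π p : N, TangentSpace 𝓘(ℝ, F) p →L[ℝ] ℝ}
    {f : M → N} {p : M} (hf : ContMDiffAt 𝓘(ℝ, E) 𝓘(ℝ, F) 2 f p)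
    (hθ : DifferentiableAt ℝ (chartForm θ (f p)) (extChartAt 𝓘(ℝ, F) (f p) (f p)))
    {K L : Π p : M, TangentSpace 𝓘(ℝ, E) p}
    (hK : MDifferentiableAt 𝓘(ℝ, E) (𝓘(ℝ, E).prod 𝓘(ℝ, E))
      (fun p ↦ TotalSpace.mk' E (E := fun p : M ↦ TangentSpace 𝓘(ℝ, E) p) p (K p)) p)
    (hL : MDifferentiableAt 𝓘(ℝ, E) (𝓘(ℝ, E).prod 𝓘(ℝ, E))
      (fun p ↦ TotalSpace.mk' E (E := fun p : M ↦ TangentSpace 𝓘(ℝ, E) p) p (L p)) p) :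
    2 * extDerivOneForm θ (f p) (mfderiv 𝓘(ℝ, E) 𝓘(ℝ, F) f p (K p))
        (mfderiv 𝓘(ℝ, E) 𝓘(ℝ, F) f p (L p)) =
      mvfderiv 𝓘(ℝ, E) (fun q ↦ θ (f q) (mfderiv 𝓘(ℝ, E) 𝓘(ℝ, F) f q (L q))) p (K p)
      - mvfderiv 𝓘(ℝ, E) (fun q ↦ θ (f q) (mfderiv 𝓘(ℝ, E) 𝓘(ℝ, F) f q (K q))) p (L p)
      - θ (f p) (mfderiv 𝓘(ℝ, E) 𝓘(ℝ, F) f p (VectorField.mlieBracket 𝓘(ℝ, E) K L p)) := by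
  rw [extDerivOneForm_eq_fderiv_chartForm hθ, mvfderiv_pullback_sub hf hθ hK hL]
  ring

/-- In the formula for `dθ` the two functions being differentiated vanish identically near `p`, so
only the bracket term survives. -/
theorem apply_mlieBracket_of_eventually_apply_eq_zero
    {θ : Π p : N, TangentSpace 𝓘(ℝ, F) p →L[ℝ] ℝ}
    {f : M → N} {p : M} (hf : ContMDiffAt 𝓘(ℝ, E) 𝓘(ℝ, F) 2 f p)
    (hθ : DifferentiableAt ℝ (chartForm θ (f p)) (extChartAt 𝓘(ℝ, F) (f p) (f p)))
    {K L : Π p : M, TangentSpace 𝓘(ℝ, E) p}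
    (hK : MDifferentiableAt 𝓘(ℝ, E) (𝓘(ℝ, E).prod 𝓘(ℝ, E))
      (fun p ↦ TotalSpace.mk' E (E := fun p : M ↦ TangentSpace 𝓘(ℝ, E) p) p (K p)) p)
    (hL : MDifferentiableAt 𝓘(ℝ, E) (𝓘(ℝ, E).prod 𝓘(ℝ, E))
      (fun p ↦ TotalSpace.mk' E (E := fun p : M ↦ TangentSpace 𝓘(ℝ, E) p) p (L p)) p)
    (hK0 : ∀ᶠ q in 𝓝 p, θ (f q) (mfderiv 𝓘(ℝ, E) 𝓘(ℝ, F) f q (K q)) = 0)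
    (hL0 : ∀ᶠ q in 𝓝 p, θ (f q) (mfderiv 𝓘(ℝ, E) 𝓘(ℝ, F) f q (L q)) = 0) :
    θ (f p) (mfderiv 𝓘(ℝ, E) 𝓘(ℝ, F) f p (VectorField.mlieBracket 𝓘(ℝ, E) K L p)) =
      - (2 * extDerivOneForm θ (f p) (mfderiv 𝓘(ℝ, E) 𝓘(ℝ, F) f p (K p))
        (mfderiv 𝓘(ℝ, E) 𝓘(ℝ, F) f p (L p))) := by
  have key : ∀ h : M → ℝ, (∀ᶠ q in 𝓝 p, h q = 0) → mvfderiv 𝓘(ℝ, E) h p = 0 := by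
    intro h hh
    have h1 : HasMFDerivAt 𝓘(ℝ, E) 𝓘(ℝ, ℝ) h p 0 :=
      (hasMFDerivAt_const (0 : ℝ) p).congr_of_eventuallyEq hh
    rw [mvfderiv, h1.mfderiv]
    rfl
  rw [extDerivOneForm_pullback hf hθ hK hL, key _ hK0, key _ hL0]
  simp

end Real

/-! ### Holomorphic maps as real maps -/

section Complex

variable {E F : Type*} [NormedAddCommGroup E] [NormedSpace ℂ E] [NormedAddCommGroup F]
  [NormedSpace ℂ F]
  {M : Type*} [TopologicalSpace M] [ChartedSpace E M]
  {N : Type*} [TopologicalSpace N] [ChartedSpace F N]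

/-- The real and the complex manifold have the same charts, so both derivatives are derivatives of
the same coordinate expression. -/
theorem mfderiv_real_eq_restrictScalars {f : M → N} {p : M}
    (hf : MDifferentiableAt 𝓘(ℂ, E) 𝓘(ℂ, F) f p) :
    mfderiv 𝓘(ℝ, E) 𝓘(ℝ, F) f p =
      (mfderiv 𝓘(ℂ, E) 𝓘(ℂ, F) f p : E →L[ℂ] F).restrictScalars ℝ :=
  HasMFDerivAt.mfderiv ⟨hf.hasMFDerivAt.1, HasFDerivWithinAt.restrictScalars ℝ hf.hasMFDerivAt.2⟩

theorem mfderiv_apply_J {f : M → N} {p : M} (hf : MDifferentiableAt 𝓘(ℂ, E) 𝓘(ℂ, F) f p)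
    (x : TangentSpace 𝓘(ℝ, E) p) :
    mfderiv 𝓘(ℝ, E) 𝓘(ℝ, F) f p (J p x) = J (f p) (mfderiv 𝓘(ℝ, E) 𝓘(ℝ, F) f p x) := by
  rw [mfderiv_real_eq_restrictScalars hf]
  exact (mfderiv 𝓘(ℂ, E) 𝓘(ℂ, F) f p : E →L[ℂ] F).map_smul Complex.I (show E from x)

theorem mfderiv_real_injective {f : M → N} {p : M} (hf : MDifferentiableAt 𝓘(ℂ, E) 𝓘(ℂ, F) f p)
    (h : Function.Injective (mfderiv 𝓘(ℂ, E) 𝓘(ℂ, F) f p)) :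
    Function.Injective (mfderiv 𝓘(ℝ, E) 𝓘(ℝ, F) f p) := by
  rw [mfderiv_real_eq_restrictScalars hf]
  exact h

theorem contMDiffAt_real_of_complex {f : M → N} {p : M} {n : WithTop ℕ∞}
    (hf : ContMDiffAt 𝓘(ℂ, E) 𝓘(ℂ, F) n f p) : ContMDiffAt 𝓘(ℝ, E) 𝓘(ℝ, F) n f p := by
  rw [contMDiffAt_iff] at hf ⊢
  exact ⟨hf.1, ContDiffWithinAt.restrict_scalars ℝ hf.2⟩

theorem J_J (p : N) (x : TangentSpace 𝓘(ℝ, F) p) : J p (J p x) = -x := by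
  have h : ∀ y : F, Complex.I • Complex.I • y = -y := fun y ↦ by
    rw [smul_smul, Complex.I_mul_I, neg_one_smul]
  exact h x

variable [IsManifold 𝓘(ℂ, F) ω N]

/-- The form `u ∘ J` in a chart. -/
theorem differentiableAt_chartForm_comp_J {u v : Π p : N, TangentSpace 𝓘(ℝ, F) p →L[ℝ] ℝ} {p : N}
    (hu : DifferentiableAt ℝ (chartForm u p) (extChartAt 𝓘(ℝ, F) p p))
    (huv : ∀ᶠ q in 𝓝 p, v q = (u q).comp (J q)) :
    DifferentiableAt ℝ (chartForm v p) (extChartAt 𝓘(ℝ, F) p p) := by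
  have hφc : Filter.Tendsto (extChartAt 𝓘(ℝ, F) p).symm (𝓝 (extChartAt 𝓘(ℝ, F) p p)) (𝓝 p) := by
    have := continuousAt_extChartAt_symm (I := 𝓘(ℝ, F)) p
    rwa [ContinuousAt, extChartAt_to_inv] at this
  have h1 : DifferentiableAt ℝ
      (fun y ↦ (chartForm u p y).comp (Complex.I • ContinuousLinearMap.id ℝ F : F →L[ℝ] F))
      (extChartAt 𝓘(ℝ, F) p p) := hu.clm_comp (differentiableAt_const _)
  refine h1.congr_of_eventuallyEq ?_
  filter_upwards [hφc.eventually huv, extChartAt_target_mem_nhds (I := 𝓘(ℝ, F)) p] with y hy hy'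
  -- The inverse chart is holomorphic, so its derivative commutes with `J`: in the chart, `J`
  -- becomes the constant map of multiplication by `i`.
  have hd : MDifferentiableAt 𝓘(ℂ, F) 𝓘(ℂ, F) (extChartAt 𝓘(ℂ, F) p).symm y := by
    have := mdifferentiableWithinAt_extChartAt_symm (I := 𝓘(ℂ, F)) (x := p) (z := y) hy'
    rwa [modelWithCornersSelf_coe, Set.range_id, mdifferentiableWithinAt_univ] at this
  ext x
  have h2 := mfderiv_apply_J hd x
  have h3 := congrArg (fun A : F →L[ℝ] ℝ ↦ A ((mfderiv 𝓘(ℝ, F) 𝓘(ℝ, F)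
    (extChartAt 𝓘(ℝ, F) p).symm y : F →L[ℝ] F) x)) hy
  exact h3.trans (congrArg (u ((extChartAt 𝓘(ℝ, F) p).symm y) : F →L[ℝ] ℝ) h2.symm)

end Complex

/-! ### Pointwise algebra of the almost contact structure -/

section Structure

variable {m : ℕ} {ι : Type*} {F : Type*} [NormedAddCommGroup F] [NormedSpace ℂ F]
  {N : Type*} [TopologicalSpace N] [ChartedSpace F N] [IsManifold 𝓘(ℂ, F) ω N]
  [RiemannianBundle (fun p : N ↦ TangentSpace 𝓘(ℝ, F) p)] {𝒰 : ι → Set N}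

namespace ComplexAlmostContactMetricStructure

variable (S : ComplexAlmostContactMetricStructure m F 𝒰) {i : ι} {p : N}

theorem inner_J_left (S : ComplexAlmostContactMetricStructure m F 𝒰) {p : N}
    (x y : TangentSpace 𝓘(ℝ, F) p) :
    (inner ℝ (J p x) y : ℝ) = - inner ℝ x (J p y) := by
  have := S.hermitian p x (J p y)
  rw [J_J, inner_neg_right] at this
  linarith

theorem v_apply (hp : p ∈ 𝒰 i) (x : TangentSpace 𝓘(ℝ, F) p) :
    S.v i p x = inner ℝ x (S.V i p) := by
  rw [S.v_eq i p hp, S.V_eq i p hp, ContinuousLinearMap.comp_apply, S.u_eq i p hp,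
    S.inner_J_left, inner_neg_right]

theorem H_apply (hp : p ∈ 𝒰 i) (x : TangentSpace 𝓘(ℝ, F) p) :
    S.H i p x = S.G i p (J p x) := by
  rw [S.H_eq i p hp, ContinuousLinearMap.comp_apply]

/-- `G` and `J` are skew and anticommute, hence `H = G J` is skew. -/
theorem H_skew (hp : p ∈ 𝒰 i) (x y : TangentSpace 𝓘(ℝ, F) p) :
    (inner ℝ x (S.H i p y) : ℝ) = - inner ℝ (S.H i p x) y := by
  rw [S.H_apply hp, S.H_apply hp, S.G_skew i p hp, S.G_J i p hp, inner_neg_left, S.inner_J_left,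
    neg_neg]

theorem G_V (hp : p ∈ 𝒰 i) : S.G i p (S.V i p) = 0 := by
  rw [S.V_eq i p hp, map_neg, S.G_J i p hp, S.G_U i p hp, map_zero, neg_zero, neg_zero]

theorem inner_G_U (hp : p ∈ 𝒰 i) (x : TangentSpace 𝓘(ℝ, F) p) :
    (inner ℝ (S.G i p x) (S.U i p) : ℝ) = 0 := by
  have := S.G_skew i p hp x (S.U i p)
  rw [S.G_U i p hp, inner_zero_right] at this
  linarith

theorem inner_G_V (hp : p ∈ 𝒰 i) (x : TangentSpace 𝓘(ℝ, F) p) :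
    (inner ℝ (S.G i p x) (S.V i p) : ℝ) = 0 := by
  have := S.G_skew i p hp x (S.V i p)
  rw [S.G_V hp, inner_zero_right] at this
  linarith

theorem G_G_of_orthogonal (hp : p ∈ 𝒰 i) {x : TangentSpace 𝓘(ℝ, F) p}
    (hU : (inner ℝ x (S.U i p) : ℝ) = 0) (hV : (inner ℝ x (S.V i p) : ℝ) = 0) :
    S.G i p (S.G i p x) = -x := by
  rw [S.G_sq i p hp, S.u_eq i p hp, S.v_apply hp, hU, hV, zero_smul, zero_smul, add_zero, add_zero]

/-- The invariant distribution imposes its condition for every index at once. This handles a second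
index `j` when `G x` is formed with `i`. -/
theorem G_G_overlap {j : ι} (hi : p ∈ 𝒰 i) (hj : p ∈ 𝒰 j) {x : TangentSpace 𝓘(ℝ, F) p}
    (hU : (inner ℝ x (S.U i p) : ℝ) = 0) (hV : (inner ℝ x (S.V i p) : ℝ) = 0) :
    ∃ c d : ℝ, S.G j p (S.G i p x) = c • x + d • J p x := by
  obtain ⟨c, d, -, -, -, hG, -⟩ := S.overlap i j p ⟨hi, hj⟩
  -- With `G' = c G - d G J` and `G J G = -J G²`, one gets `G' G x = c G² x + d J G² x = -c x - d J
  -- x`.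
  refine ⟨-c, -d, ?_⟩
  rw [hG, sub_apply, smul_apply,
    smul_apply, S.H_apply hi, S.G_J i p hi, S.G_G_of_orthogonal hi hU hV,
    map_neg]
  simp only [smul_neg, neg_smul, neg_neg, sub_eq_add_neg]

theorem inner_G_overlap {j : ι} (hi : p ∈ 𝒰 i) (hj : p ∈ 𝒰 j) (x : TangentSpace 𝓘(ℝ, F) p) :
    (inner ℝ (S.G i p x) (S.U j p) : ℝ) = 0 ∧ (inner ℝ (S.G i p x) (S.V j p) : ℝ) = 0 := by
  obtain ⟨c, d, -, hu, hv, -, -⟩ := S.overlap i j p ⟨hi, hj⟩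
  rw [← S.u_eq j p hj, ← S.v_apply hj, hu, hv]
  simp [S.u_eq i p hi, S.v_apply hi, S.inner_G_U hi, S.inner_G_V hi]

theorem differentiableAt_chartForm_u (hp : p ∈ 𝒰 i) :
    DifferentiableAt ℝ (chartForm (S.u i) p) (extChartAt 𝓘(ℝ, F) p p) :=
  differentiableAt_chartForm
    (((S.smooth_u i).contMDiffAt ((S.isOpen i).mem_nhds hp)).mdifferentiableAt (by simp))

theorem differentiableAt_chartForm_v (hp : p ∈ 𝒰 i) :
    DifferentiableAt ℝ (chartForm (S.v i) p) (extChartAt 𝓘(ℝ, F) p p) :=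
  differentiableAt_chartForm_comp_J (S.differentiableAt_chartForm_u hp)
    (Filter.eventually_of_mem ((S.isOpen i).mem_nhds hp) fun q hq ↦ S.v_eq i q hq)

end ComplexAlmostContactMetricStructure

end Structure

/-! ### The invariant distribution and brackets of its sections -/

section Submanifold

namespace ComplexContactMetricStructure

variable {m : ℕ} {ι : Type*} {E F : Type*} [NormedAddCommGroup E] [NormedSpace ℂ E]
  [NormedAddCommGroup F] [NormedSpace ℂ F] [FiniteDimensional ℂ F]
  {M : Type*} [TopologicalSpace M] [ChartedSpace E M]
  {N : Type*} [TopologicalSpace N] [ChartedSpace F N] [IsManifold 𝓘(ℂ, F) ω N]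
  [RiemannianBundle (fun p : N ↦ TangentSpace 𝓘(ℝ, F) p)] {𝒰 : ι → Set N}
  (S : ComplexContactMetricStructure m F 𝒰) {f : M → N}

theorem mem_orthUV {i : ι} {p : M} {x : TangentSpace 𝓘(ℝ, E) p} :
    x ∈ S.orthUV (E := E) f i p ↔
      (inner ℝ (mfderiv 𝓘(ℝ, E) 𝓘(ℝ, F) f p x) (S.U i (f p)) : ℝ) = 0 ∧
      (inner ℝ (mfderiv 𝓘(ℝ, E) 𝓘(ℝ, F) f p x) (S.V i (f p)) : ℝ) = 0 := by
  rw [orthUV, Submodule.mem_comap, Submodule.mem_orthogonal']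
  constructor
  · intro h
    exact ⟨h _ (Submodule.subset_span (by simp)), h _ (Submodule.subset_span (by simp))⟩
  · rintro ⟨h1, h2⟩ w hw
    obtain ⟨a, b, rfl⟩ := Submodule.mem_span_pair.1 hw
    rw [inner_add_right, inner_smul_right, inner_smul_right]
    simp only [ContinuousLinearMap.coe_coe, h1, h2, mul_zero, add_zero]

theorem mem_ker_Q {i : ι} {p : M} {x : TangentSpace 𝓘(ℝ, E) p} :
    x ∈ (S.Q (E := E) f i p).ker ↔
      S.G i (f p) (mfderiv 𝓘(ℝ, E) 𝓘(ℝ, F) f p x) ∈ tangentImage (E := E) f p := by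
  rw [LinearMap.mem_ker]
  change (tangentImage (E := E) f p)ᗮ.starProjection
    (S.G i (f p) (mfderiv 𝓘(ℝ, E) 𝓘(ℝ, F) f p x)) = 0 ↔ _
  rw [Submodule.starProjection_apply_eq_zero_iff, Submodule.orthogonal_orthogonal]

theorem mem_invDist {p : M} {x : TangentSpace 𝓘(ℝ, E) p} :
    x ∈ S.invDist (E := E) f p ↔ ∀ i, f p ∈ 𝒰 i →
      ((inner ℝ (mfderiv 𝓘(ℝ, E) 𝓘(ℝ, F) f p x) (S.U i (f p)) : ℝ) = 0 ∧
      (inner ℝ (mfderiv 𝓘(ℝ, E) 𝓘(ℝ, F) f p x) (S.V i (f p)) : ℝ) = 0) ∧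
      S.G i (f p) (mfderiv 𝓘(ℝ, E) 𝓘(ℝ, F) f p x) ∈ tangentImage (E := E) f p := by
  simp only [invDist, Submodule.mem_iInf, Submodule.mem_inf, mem_orthUV, mem_ker_Q]

/-- `G` maps the invariant distribution into itself. -/
theorem exists_mem_invDist_mfderiv_eq_G {i : ι} {p : M} (hp : f p ∈ 𝒰 i)
    (hf : MDifferentiableAt 𝓘(ℂ, E) 𝓘(ℂ, F) f p)
    {x : TangentSpace 𝓘(ℝ, E) p} (hx : x ∈ S.invDist (E := E) f p) :
    ∃ y ∈ S.invDist (E := E) f p, mfderiv 𝓘(ℝ, E) 𝓘(ℝ, F) f p y =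
      S.G i (f p) (mfderiv 𝓘(ℝ, E) 𝓘(ℝ, F) f p x) := by
  obtain ⟨⟨hU, hV⟩, y, hy⟩ := S.mem_invDist.1 hx i hp
  have hy' : mfderiv 𝓘(ℝ, E) 𝓘(ℝ, F) f p y =
    S.G i (f p) (mfderiv 𝓘(ℝ, E) 𝓘(ℝ, F) f p x) := hy
  refine ⟨y, S.mem_invDist.2 fun j hj ↦ ?_, hy'⟩
  rw [hy']
  refine ⟨S.inner_G_overlap hp hj _, ?_⟩
  -- Tangency of `G' G x` uses that `M` is a complex submanifold: `x` and `J x` are both tangent,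
  -- hence so is every combination of them.
  obtain ⟨c, d, h⟩ := S.G_G_overlap hp hj hU hV
  refine ⟨c • x + d • J p x, ?_⟩
  rw [h, ← mfderiv_apply_J hf]
  change mfderiv 𝓘(ℝ, E) 𝓘(ℝ, F) f p (c • x + d • J p x) = _
  rw [map_add, map_smul, map_smul]

variable [CompleteSpace E] [IsManifold 𝓘(ℂ, E) ω M]

/-- Both `u` and `v` vanish along sections of the distribution. Their vanishing near `p` reduces the
bracket to `-2 du` and `-2 dv`, their vanishing at `p` kills the `σ` terms, and skewness of `G` and
`H` absorbs the sign. -/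
theorem inner_mlieBracket {i : ι} {p : M} (hp : f p ∈ 𝒰 i)
    (hf : ContMDiffAt 𝓘(ℂ, E) 𝓘(ℂ, F) ω f p) {K L : Π p : M, TangentSpace 𝓘(ℝ, E) p}
    (hK : IsSmoothSectionOn (S.invDist (E := E) f) Set.univ K)
    (hL : IsSmoothSectionOn (S.invDist (E := E) f) Set.univ L) :
    (inner ℝ (mfderiv 𝓘(ℝ, E) 𝓘(ℝ, F) f p (VectorField.mlieBracket 𝓘(ℝ, E) K L p))
        (S.U i (f p)) : ℝ)
      = 2 * inner ℝ (S.G i (f p) (mfderiv 𝓘(ℝ, E) 𝓘(ℝ, F) f p (K p)))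
          (mfderiv 𝓘(ℝ, E) 𝓘(ℝ, F) f p (L p)) ∧
    (inner ℝ (mfderiv 𝓘(ℝ, E) 𝓘(ℝ, F) f p (VectorField.mlieBracket 𝓘(ℝ, E) K L p))
        (S.V i (f p)) : ℝ)
      = 2 * inner ℝ (S.H i (f p) (mfderiv 𝓘(ℝ, E) 𝓘(ℝ, F) f p (K p)))
          (mfderiv 𝓘(ℝ, E) 𝓘(ℝ, F) f p (L p)) := by
  have : CompleteSpace F := FiniteDimensional.complete ℂ F
  have hfR : ContMDiffAt 𝓘(ℝ, E) 𝓘(ℝ, F) 2 f p := (contMDiffAt_real_of_complex hf).of_le le_top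
  have hnhds : ∀ᶠ q in 𝓝 p, f q ∈ 𝒰 i :=
    hfR.continuousAt.eventually ((S.toComplexAlmostContactMetricStructure.isOpen i).mem_nhds hp)
  have hsmooth : ∀ {X : Π p : M, TangentSpace 𝓘(ℝ, E) p},
      IsSmoothSectionOn (S.invDist (E := E) f) Set.univ X →
      MDifferentiableAt 𝓘(ℝ, E) (𝓘(ℝ, E).prod 𝓘(ℝ, E))
      (fun p ↦ TotalSpace.mk' E (E := fun p : M ↦ TangentSpace 𝓘(ℝ, E) p) p (X p)) p := fun hX ↦
    (hX.smooth.contMDiffAt Filter.univ_mem).mdifferentiableAt (by simp)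
  have hu : ∀ {X : Π p : M, TangentSpace 𝓘(ℝ, E) p},
      IsSmoothSectionOn (S.invDist (E := E) f) Set.univ X →
      ∀ᶠ q in 𝓝 p, S.u i (f q) (mfderiv 𝓘(ℝ, E) 𝓘(ℝ, F) f q (X q)) = 0 := fun hX ↦
    hnhds.mono fun q hq ↦ by
      rw [S.u_eq i _ hq]; exact (S.mem_invDist.1 (hX.mem q trivial) i hq).1.1
  have hv : ∀ {X : Π p : M, TangentSpace 𝓘(ℝ, E) p},
      IsSmoothSectionOn (S.invDist (E := E) f) Set.univ X →
      ∀ᶠ q in 𝓝 p, S.v i (f q) (mfderiv 𝓘(ℝ, E) 𝓘(ℝ, F) f q (X q)) = 0 := fun hX ↦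
    hnhds.mono fun q hq ↦ by
      rw [S.v_apply hq]; exact (S.mem_invDist.1 (hX.mem q trivial) i hq).1.2
  rw [← S.u_eq i _ hp, ← S.v_apply hp]
  constructor
  · rw [apply_mlieBracket_of_eventually_apply_eq_zero hfR (S.differentiableAt_chartForm_u hp)
      (hsmooth hK) (hsmooth hL) (hu hK) (hu hL), S.du_eq i _ hp, (hv hK).self_of_nhds,
      (hv hL).self_of_nhds, S.G_skew i _ hp]
    ring
  · rw [apply_mlieBracket_of_eventually_apply_eq_zero hfR (S.differentiableAt_chartForm_v hp)
      (hsmooth hK) (hsmooth hL) (hv hK) (hv hL), S.dv_eq i _ hp, (hu hK).self_of_nhds,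
      (hu hL).self_of_nhds, S.H_skew hp]
    ring

end ComplexContactMetricStructure

end Submanifold

/-- A vector of a distribution extends to a global smooth section. -/
theorem IsDistribution.exists_isSmoothSectionOn_univ {E : Type*} [NormedAddCommGroup E]
    [NormedSpace ℝ E] [FiniteDimensional ℝ E] {M : Type*} [TopologicalSpace M] [T2Space M]
    [ChartedSpace E M] [IsManifold 𝓘(ℝ, E) ω M]
    {D : Π p : M, Submodule ℝ (TangentSpace 𝓘(ℝ, E) p)} (hD : IsDistribution D) {p : M}
    {x : TangentSpace 𝓘(ℝ, E) p} (hx : x ∈ D p) :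
    ∃ X : Π q : M, TangentSpace 𝓘(ℝ, E) q, IsSmoothSectionOn D Set.univ X ∧ X p = x := by
  obtain ⟨W, hW, hpW, X, hX, rfl⟩ := hD.smooth p x hx
  -- `X` is uncontrolled outside `W`, so it is cut off by a bump function with closed support inside
  -- `W`; Hausdorffness makes the bump function smooth on all of `M`. Smoothness is then checked on
  -- the support and on its open complement, where the product is zero.
  obtain ⟨ρ, -, hρ⟩ := (SmoothBumpFunction.nhds_basis_tsupport (I := 𝓘(ℝ, E)) p).mem_iff.1
    (hW.mem_nhds hpW)
  refine ⟨fun q ↦ ρ q • X q, ⟨?_, fun q _ ↦ ?_⟩, by simp⟩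
  · rw [contMDiffOn_univ]
    intro q
    by_cases hq : q ∈ tsupport ρ
    · exact ρ.contMDiffAt.smul_section (hX.smooth.contMDiffAt (hW.mem_nhds (hρ hq)))
    · have h0 : ∀ᶠ q' in 𝓝 q, ρ q' = 0 :=
        Filter.eventually_of_mem ((isClosed_tsupport ρ).isOpen_compl.mem_nhds hq)
          fun q' hq' ↦ image_eq_zero_of_notMem_tsupport hq'
      refine ((contMDiff_zeroSection ℝ (TangentSpace 𝓘(ℝ, E) (M := M))).contMDiffAt
        (x := q)).congr_of_eventuallyEq ?_
      filter_upwards [h0] with q' hq'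
      rw [hq', zero_smul]
      rfl
  · by_cases hq : q ∈ tsupport ρ
    · exact (D q).smul_mem _ (hX.mem q (hρ hq))
    · rw [image_eq_zero_of_notMem_tsupport hq, zero_smul]
      exact (D q).zero_mem

end ComplexContact

/-! ### Non-involutivity of the invariant distribution -/

theorem mainTheorem3 {m : ℕ} {ι : Type*} {E F : Type*}
    [NormedAddCommGroup E] [NormedSpace ℂ E] [FiniteDimensional ℂ E]
    [NormedAddCommGroup F] [NormedSpace ℂ F] [FiniteDimensional ℂ F]
    {M : Type*} [TopologicalSpace M] [T2Space M] [ChartedSpace E M] [IsManifold 𝓘(ℂ, E) ω M]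
    {N : Type*} [TopologicalSpace N] [ChartedSpace F N] [IsManifold 𝓘(ℂ, F) ω N]
    [RiemannianBundle (fun p : N ↦ TangentSpace 𝓘(ℝ, F) p)]
    [IsContMDiffRiemannianBundle 𝓘(ℝ, F) ∞ F (fun p : N ↦ TangentSpace 𝓘(ℝ, F) p)]
    {𝒰 : ι → Set N} (S : ComplexContact.ComplexContactMetricStructure m F 𝒰) (hS : S.IsNormal)
    (f : M → N) (hf : S.IsSemiInvariant (E := E) f)
    (hD : ∃ p, S.invDist (E := E) f p ≠ ⊥) :
    ¬ ComplexContact.IsInvolutive (S.invDist (E := E) f) ∧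
    (∀ K L : Π p : M, TangentSpace 𝓘(ℝ, E) p,
      ComplexContact.IsSmoothSectionOn (S.invDist (E := E) f) Set.univ K →
      ComplexContact.IsSmoothSectionOn (S.invDist (E := E) f) Set.univ L →
      ∀ i p, f p ∈ 𝒰 i →
        (inner ℝ (mfderiv 𝓘(ℝ, E) 𝓘(ℝ, F) f p (VectorField.mlieBracket 𝓘(ℝ, E) K L p))
            (S.U i (f p)) : ℝ)
          = 2 * inner ℝ (S.G i (f p) (mfderiv 𝓘(ℝ, E) 𝓘(ℝ, F) f p (K p)))
              (mfderiv 𝓘(ℝ, E) 𝓘(ℝ, F) f p (L p)) ∧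
        (inner ℝ (mfderiv 𝓘(ℝ, E) 𝓘(ℝ, F) f p (VectorField.mlieBracket 𝓘(ℝ, E) K L p))
            (S.V i (f p)) : ℝ)
          = 2 * inner ℝ (S.H i (f p) (mfderiv 𝓘(ℝ, E) 𝓘(ℝ, F) f p (K p)))
              (mfderiv 𝓘(ℝ, E) 𝓘(ℝ, F) f p (L p))) ∧
    (∀ i p, f p ∈ 𝒰 i → ∃ K L : Π p : M, TangentSpace 𝓘(ℝ, E) p,
      ComplexContact.IsSmoothSectionOn (S.invDist (E := E) f) Set.univ K ∧
      ComplexContact.IsSmoothSectionOn (S.invDist (E := E) f) Set.univ L ∧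
      (inner ℝ (mfderiv 𝓘(ℝ, E) 𝓘(ℝ, F) f p (VectorField.mlieBracket 𝓘(ℝ, E) K L p))
        (S.U i (f p)) : ℝ) ≠ 0) := by
  have hfc := hf.immersion.holomorphic
  have hfd : ∀ p, MDifferentiableAt 𝓘(ℂ, E) 𝓘(ℂ, F) f p := fun p ↦
    (hfc p).mdifferentiableAt (by simp)
  have : CompleteSpace E := FiniteDimensional.complete ℂ E
  have : FiniteDimensional ℝ E := FiniteDimensional.complexToReal E
  have hformula := fun (K L : Π p : M, TangentSpace 𝓘(ℝ, E) p)
    (hK : ComplexContact.IsSmoothSectionOn (S.invDist (E := E) f) Set.univ K)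
    (hL : ComplexContact.IsSmoothSectionOn (S.invDist (E := E) f) Set.univ L) i p
    (hp : f p ∈ 𝒰 i) ↦ S.inner_mlieBracket hp (hfc p) hK hL
  have hexists : ∀ i p, f p ∈ 𝒰 i → ∃ K L : Π p : M, TangentSpace 𝓘(ℝ, E) p,
      ComplexContact.IsSmoothSectionOn (S.invDist (E := E) f) Set.univ K ∧
      ComplexContact.IsSmoothSectionOn (S.invDist (E := E) f) Set.univ L ∧
      (inner ℝ (mfderiv 𝓘(ℝ, E) 𝓘(ℝ, F) f p (VectorField.mlieBracket 𝓘(ℝ, E) K L p))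
        (S.U i (f p)) : ℝ) ≠ 0 := by
    intro i p hp
    obtain ⟨r, hr⟩ := hf.invDist.const_rank
    -- Constant rank carries non-triviality from one point to every point.
    have hDp : S.invDist (E := E) f p ≠ ⊥ := by
      obtain ⟨p₀, hp₀⟩ := hD
      intro h
      have h0 := hr p
      rw [h, finrank_bot] at h0
      exact hp₀ (Submodule.finrank_eq_zero.1 ((hr p₀).trans h0.symm))
    obtain ⟨x, hx, hx0⟩ := Submodule.exists_mem_ne_zero_of_ne_bot hDp
    -- The second vector is `G x`, which turns `2 g(G x, y)` into `2 |G x|²`.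
    obtain ⟨y, hy, hxy⟩ := S.exists_mem_invDist_mfderiv_eq_G hp (hfd p) hx
    obtain ⟨K, hK, rfl⟩ := hf.invDist.exists_isSmoothSectionOn_univ hx
    obtain ⟨L, hL, rfl⟩ := hf.invDist.exists_isSmoothSectionOn_univ hy
    refine ⟨K, L, hK, hL, ?_⟩
    rw [(hformula K L hK hL i p hp).1, hxy]
    obtain ⟨⟨hU, hV⟩, -⟩ := S.mem_invDist.1 hx i hp
    have hGG := S.G_G_of_orthogonal hp hU hV
    -- If `G x = 0` then `-x = G (G x) = 0` in the ambient tangent space, so `x = 0` because `f` is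
    -- an immersion.
    refine mul_ne_zero two_ne_zero (inner_self_ne_zero.2 fun h ↦ hx0 ?_)
    rw [h, map_zero, eq_comm, neg_eq_zero] at hGG
    exact ComplexContact.mfderiv_real_injective (hfd p) (hf.immersion.injective p)
      (hGG.trans (map_zero _).symm)
  refine ⟨fun hinv ↦ ?_, hformula, hexists⟩
  obtain ⟨p, -⟩ := hD
  obtain ⟨i, hi⟩ := S.toComplexAlmostContactMetricStructure.cover (f p)
  obtain ⟨K, L, hK, hL, h⟩ := hexists i p hi
  exact h (S.mem_invDist.1 (hinv K L hK hL p) i hi).1.1
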